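/- Notation. The $64$ vertices $v\in\mathbb F_2^6$ of the $6$-cube index $64$ physical qubits. For $J\subset\{1,\dots,6\}$ and a vertex $v$, the subcube $v+\langle J\rangle$ of type $J$ is the set of vertices that agree with $v$ on all coordinates outside $J$; $\langle J\rangle$ is the one through $0$; a square is a subcube with $|J|=2$. For a set $V$ of vertices, $X(V)$ (resp. $Z(V)$) acts by $X$ (resp. $Z$) on the qubits of $V$ and trivially elsewhere. $RM_6(r)\subset\mathbb F_2^{\mathbb F_2^6}$ is the space of functions given by polynomials of degree at most $r$, and $QRM_6(1,2)$ is the CSS code with $X$ stabilizer group $RM_6(1)$ and $Z$ stabilizer group $RM_6(3)$, sets of vertices being identified with their indicator functions. The operator $\widetilde T$ on the $6$-cube is the product operator that acts by $T=\mathrm{diag}(1,e^{i\pi/4})$ on the vertices of even Hamming weight and by $T^\dagger$ on those of odd Hamming weight. Put $I_1=\{1,2\}$, $I_2=\{3,4\}$, $I_3=\{5,6\}$. The big unfolded code is the CSS code on these $64$ qubits with $X$ stabilizer group $RM_6(1)$ and $Z$ stabilizer group generated by all squares of the $12$ types $J$, $|J|=2$, $J\notin\{I_1,I_2,I_3\}$.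 Theorem. 1. The big unfolded code is $QRM_6(1,2)$ with $12$ extra independent $Z$ stabilizers: it has the same $X$ stabilizer group, and its $Z$ stabilizer group is generated by that of $QRM_6(1,2)$ together with one square of each of the $12$ types, however these squares are chosen. The $Z$ stabilizer groups have dimensions $42$ for $QRM_6(1,2)$ and $54$ for the big unfolded code. 2. The code space of the big unfolded code is contained in that of $QRM_6(1,2)$ and has dimension $2^3$. There is an isometry $E:(\mathbb C^2)^{\otimes 3}\to(\mathbb C^2)^{\otimes 64}$ onto this code space with $X(\langle\overline{I_k}\rangle)E=EX_k$ and $Z(\langle I_k\rangle)E=EZ_k$ for $k=1,2,3$, where $\overline{I_k}$ is the complement of $I_k$ and $X_k,Z_k$ are the Pauli operators of the logical qubit $k$, which is called the logical qubit $I_k$. The following holds for every such $E$. 3. For all $k$ and all vertices $v$, $X(v+\langle\overline{I_k}\rangle)E=EX_k$ and $Z(v+\langle I_k\rangle)E=EZ_k$. 4. The logical action of $\widetilde T$ on the whole $6$-cube is a single $CCZ$ on the three logical qubits $\{1,2\},\{3,4\},\{5,6\}$: $\widetilde T\,E=E\;CCZ$. 5. Hence the code is a $64\,|T\rangle\to|CCZ\rangle$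 factory, where $|T\rangle=T|+\rangle$ and $|CCZ\rangle=CCZ|{+}{+}{+}\rangle$, in the following sense. Consume $64$ states $|T\rangle$, one for each vertex, by gate teleportation on the encoded state $E|{+}{+}{+}\rangle$: at every vertex apply a CNOT from the code qubit to its $|T\rangle$, measure the latter in the computational basis, and correct the code qubit by $S$ if the vertex has even weight and the outcome is $1$, or by $S^\dagger$ if the vertex has odd weight and the outcome is $0$. Then all $2^{64}$ outcomes have probability $2^{-64}$, and for each of them the code qubits end in the state $E|CCZ\rangle$ up to a phase. Moreover, if exactly one, two or three of the states $|T\rangle$ are replaced by $Z|T\rangle$, there is an $X$ stabilizer, depending only on the set of faulty states, of which the final state of the code qubits is an eigenvector with eigenvalue $-1$ for every outcome, so that the fault is detected. -/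

import Mathlib

open scoped Matrix

namespace BigUnfolded

/-! ### Cubes, subcubes and Reed-Muller codes -/

/-- The vertices of the `m`-cube. The coordinates `1, …, m` are indexed by `0, …, m - 1`. -/
abbrev Cube (m : ℕ) : Type := Fin m → ZMod 2

/-- The word of values of a polynomial over `𝔽₂` on the vertices of the `m`-cube. -/
noncomputable def evalWord (m : ℕ) :
    MvPolynomial (Fin m) (ZMod 2) →ₗ[ZMod 2] (Cube m → ZMod 2) where
  toFun P := fun v => MvPolynomial.eval v P
  map_add' P Q := by ext v; simp
  map_smul' c P := by ext v; simp [MvPolynomial.smul_eval]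

/-- The classical Reed-Muller code `RM_m(r)`: values of polynomials of degree at most `r`. -/
noncomputable def RM (m r : ℕ) : Submodule (ZMod 2) (Cube m → ZMod 2) :=
  (MvPolynomial.restrictTotalDegree (Fin m) (ZMod 2) r).map (evalWord m)

/-- The (indicator word of the) subcube `v + ⟨J⟩` of type `J` through the vertex `v`: the vertices
that agree with `v` on every coordinate outside `J`. -/
def subcube {m : ℕ} (J : Finset (Fin m)) (v : Cube m) : Cube m → ZMod 2 :=
  fun w => if ∀ j, j ∉ J → w j = v j then 1 else 0

/-- The space generated by all subcubes whose type belongs to `𝒯`. -/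
def Subcubes {m : ℕ} (𝒯 : Set (Finset (Fin m))) : Submodule (ZMod 2) (Cube m → ZMod 2) :=
  Submodule.span (ZMod 2) {w | ∃ J ∈ 𝒯, ∃ v : Cube m, w = subcube J v}

/-- A subcube is given by the polynomial `∏_{j ∉ J} (X_j + v_j + 1)`. -/
theorem subcube_eq_evalWord {m : ℕ} (J : Finset (Fin m)) (v : Cube m) :
    subcube J v =
      evalWord m (∏ j ∈ Jᶜ, (MvPolynomial.X j + MvPolynomial.C (v j + 1))) := by
  have key : ∀ a b : ZMod 2, a + (b + 1) = if a = b then 1 else 0 := by decide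
  ext w
  simp only [subcube, evalWord, LinearMap.coe_mk, AddHom.coe_mk, map_prod, map_add,
    MvPolynomial.eval_X, MvPolynomial.eval_C]
  split_ifs with h
  · refine (Finset.prod_eq_one fun j hj => ?_).symm
    have := key (w j) (v j)
    rw [if_pos (h j (by simpa using hj))] at this
    simpa [map_add] using this
  · push Not at h
    obtain ⟨j, hj, hne⟩ := h
    refine (Finset.prod_eq_zero (i := j) (by simpa using hj) ?_).symm
    have := key (w j) (v j)
    rw [if_neg hne] at this
    simpa [map_add] using this

theorem subcube_mem_RM {m : ℕ} (J : Finset (Fin m)) (v : Cube m) (r : ℕ) (h : m ≤ J.card + r) :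
    subcube J v ∈ RM m r := by
  rw [subcube_eq_evalWord]
  refine Submodule.mem_map_of_mem ?_
  rw [MvPolynomial.mem_restrictTotalDegree]
  refine (MvPolynomial.totalDegree_finsetProd _ _).trans ?_
  have h1 : ∀ j ∈ Jᶜ, (MvPolynomial.X j + MvPolynomial.C (v j + 1) :
      MvPolynomial (Fin m) (ZMod 2)).totalDegree ≤ 1 := fun j _ =>
    (MvPolynomial.totalDegree_add _ _).trans
      (max_le (MvPolynomial.totalDegree_X _).le (by rw [MvPolynomial.totalDegree_C]; omega))
  refine (Finset.sum_le_sum h1).trans ?_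
  have := Finset.card_add_card_compl J
  simp only [Fintype.card_fin] at this
  simp only [Finset.sum_const, smul_eq_mul, mul_one]
  omega

theorem RM_orthogonal {m q s : ℕ} (h : q + s < m) {a b : Cube m → ZMod 2}
    (ha : a ∈ RM m q) (hb : b ∈ RM m s) : a ⬝ᵥ b = 0 := by
  obtain ⟨P, hP, rfl⟩ := ha
  obtain ⟨Q, hQ, rfl⟩ := hb
  rw [SetLike.mem_coe, MvPolynomial.mem_restrictTotalDegree] at hP hQ
  have hdeg : (P * Q).totalDegree < (Fintype.card (ZMod 2) - 1) * Fintype.card (Fin m) := by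
    have := MvPolynomial.totalDegree_mul P Q
    simp only [ZMod.card, Fintype.card_fin]
    omega
  have := MvPolynomial.sum_eval_eq_zero (P * Q) hdeg
  simpa [dotProduct, evalWord] using this

/-! ### CSS codes -/

/-- A CSS code with physical qubits indexed by `ι`. Stabilizers are written as binary words, the
indicators of the sets of qubits on which they act as `X` (respectively `Z`); the two groups
commute. -/
structure CSSCode (ι : Type) [Fintype ι] where
  xStab : Submodule (ZMod 2) (ι → ZMod 2)
  zStab : Submodule (ZMod 2) (ι → ZMod 2)
  comm : ∀ a ∈ xStab, ∀ b ∈ zStab, a ⬝ᵥ b = 0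

/-- The quantum Reed-Muller code `QRM_m(q, r)`: its `X` stabilizer group is `RM_m(q)` and its `Z`
stabilizer group is `RM_m(m - r - 1)` (which is trivial for `r = m`). -/
noncomputable def QRM (m q r : ℕ) (hqr : q ≤ r) : CSSCode (Cube m) where
  xStab := RM m q
  zStab := if r < m then RM m (m - r - 1) else ⊥
  comm a ha b hb := by
    split_ifs at hb with h
    · exact RM_orthogonal (by omega) ha hb
    · rw [Submodule.mem_bot] at hb
      simp [hb]

/-- The types `{1,2}`, `{3,4}`, `{5,6}` of the three logical qubits. -/
def logicalType : Fin 3 → Finset (Fin 6) := ![{0, 1}, {2, 3}, {4, 5}]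

/-- The twelve types of squares of the `6`-cube other than `{1,2}`, `{3,4}`, `{5,6}`. -/
def extraTypes : Set (Finset (Fin 6)) := {J | J.card = 2 ∧ ∀ k, J ≠ logicalType k}

/-- The big unfolded code: its `X` stabilizer group is that of `QRM_6(1, 2)` and its `Z` stabilizer
group is generated by all squares of the twelve types other than `{1,2}`, `{3,4}`, `{5,6}`. -/
noncomputable def bigUnfolded : CSSCode (Cube 6) where
  xStab := RM 6 1
  zStab := Subcubes extraTypes
  comm a ha b hb := by
    have hle : Subcubes extraTypes ≤ RM 6 4 := by
      refine Submodule.span_le.2 ?_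
      rintro w ⟨J, hJ, v, rfl⟩
      exact subcube_mem_RM J v 4 (by have := hJ.1; omega)
    exact RM_orthogonal (by norm_num) ha (hle hb)

/-! ### Operators and states of several qubits

A system of qubits indexed by `ι` has the computational basis `ι → ZMod 2`. Its states are vectors
`(ι → ZMod 2) → ℂ` and its operators are square matrices over that index set. -/

/-- The product operator that acts by `U v` on the qubit `v`. -/
def tensorOp {ι : Type} [Fintype ι] (U : ι → Matrix (ZMod 2) (ZMod 2) ℂ) :
    Matrix (ι → ZMod 2) (ι → ZMod 2) ℂ :=
  Matrix.of fun x y => ∏ v, U v (x v) (y v)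

/-- The product state whose qubit `v` is in the state `φ v`. -/
def productState {ι : Type} [Fintype ι] (φ : ι → ZMod 2 → ℂ) : (ι → ZMod 2) → ℂ :=
  fun x => ∏ v, φ v (x v)

def gateX : Matrix (ZMod 2) (ZMod 2) ℂ := Matrix.of fun i j => if i = j then 0 else 1

def gateZ : Matrix (ZMod 2) (ZMod 2) ℂ := Matrix.diagonal fun b => if b = 0 then 1 else -1

noncomputable def gateS : Matrix (ZMod 2) (ZMod 2) ℂ :=
  Matrix.diagonal fun b => if b = 0 then 1 else Complex.I

noncomputable def gateT : Matrix (ZMod 2) (ZMod 2) ℂ :=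
  Matrix.diagonal fun b => if b = 0 then 1 else Complex.exp (Complex.I * (Real.pi / 4))

/-- `|+⟩`. -/
noncomputable def plusState : ZMod 2 → ℂ := fun _ => 1 / (Real.sqrt 2 : ℂ)

/-- `|T⟩ = T |+⟩`. -/
noncomputable def tState : ZMod 2 → ℂ := gateT *ᵥ plusState

/-- `X(V)`: it acts as `X` on the qubits of `V` and trivially on the others. -/
def opX {ι : Type} [Fintype ι] (V : ι → ZMod 2) : Matrix (ι → ZMod 2) (ι → ZMod 2) ℂ :=
  tensorOp fun v => if V v = 1 then gateX else 1

/-- `Z(V)`: it acts as `Z` on the qubits of `V` and trivially on the others. -/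
def opZ {ι : Type} [Fintype ι] (V : ι → ZMod 2) : Matrix (ι → ZMod 2) (ι → ZMod 2) ℂ :=
  tensorOp fun v => if V v = 1 then gateZ else 1

/-- `Ũ` on the set of vertices `A`: `U` on the vertices of `A` of even Hamming weight, `U†` on the
vertices of `A` of odd Hamming weight, and the identity elsewhere. -/
noncomputable def tildeOp {m : ℕ} (U : Matrix (ZMod 2) (ZMod 2) ℂ) (A : Cube m → ZMod 2) :
    Matrix (Cube m → ZMod 2) (Cube m → ZMod 2) ℂ :=
  tensorOp fun v => if A v = 1 then (if Even (hammingNorm v) then U else Uᴴ) else 1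

/-- The gate `CCZ` on three qubits. -/
def CCZ : Matrix (Fin 3 → ZMod 2) (Fin 3 → ZMod 2) ℂ :=
  Matrix.diagonal fun a => if ∀ k, a k = 1 then -1 else 1

/-- `|CCZ⟩ = CCZ |+++⟩`. -/
noncomputable def cczState : (Fin 3 → ZMod 2) → ℂ := CCZ *ᵥ productState fun _ => plusState

/-- The code space: the states fixed by all stabilizers. -/
def CSSCode.codeSpace {ι : Type} [Fintype ι] [DecidableEq ι] (C : CSSCode ι) :
    Submodule ℂ ((ι → ZMod 2) → ℂ) where
  carrier := {ψ | (∀ a ∈ C.xStab, opX a *ᵥ ψ = ψ) ∧ ∀ b ∈ C.zStab, opZ b *ᵥ ψ = ψ}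
  zero_mem' := ⟨fun _ _ => Matrix.mulVec_zero _, fun _ _ => Matrix.mulVec_zero _⟩
  add_mem' {ψ φ} hψ hφ :=
    ⟨fun a ha => by rw [Matrix.mulVec_add, hψ.1 a ha, hφ.1 a ha],
      fun b hb => by rw [Matrix.mulVec_add, hψ.2 b hb, hφ.2 b hb]⟩
  smul_mem' c {ψ} hψ :=
    ⟨fun a ha => by rw [Matrix.mulVec_smul, hψ.1 a ha],
      fun b hb => by rw [Matrix.mulVec_smul, hψ.2 b hb]⟩

/-- `E` is an encoder of `n` logical qubits into the code `C`, for which `X(lx k)` and `Z(lz k)` are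
the logical operators `X` and `Z` of the logical qubit `k`: an isometry onto the code space that
intertwines the Pauli operators of the logical qubits with these physical operators. -/
structure IsEncoder {ι : Type} [Fintype ι] [DecidableEq ι] (C : CSSCode ι) {n : ℕ}
    (lx lz : Fin n → ι → ZMod 2) (E : Matrix (ι → ZMod 2) (Fin n → ZMod 2) ℂ) : Prop where
  isometry : Eᴴ * E = 1
  range_eq : LinearMap.range E.mulVecLin = C.codeSpace
  logicalX : ∀ k, opX (lx k) * E = E * opX (Pi.single k 1)
  logicalZ : ∀ k, opZ (lz k) * E = E * opZ (Pi.single k 1)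

/-! ### The factory -/

/-- Teleportation of the gate `T̃` on the whole cube, with outcome `μ` of the measurement. The data
qubits are in the state `ψ` and there is one ancilla for each data qubit, the ancillas being in
the joint state `φ`. Every data qubit controls a `CNOT` on its ancilla, which maps the basis state
`|x⟩ |y⟩` to `|x⟩ |y + x⟩`, the ancillas are then measured in the computational basis with outcomes
`μ`, and finally a Clifford correction is applied to the data qubits: at a vertex of even weight,
`S` if the outcome is `1`; at a vertex of odd weight, `S†` if the outcome is `0`. The value is the
unnormalized state of the data qubits, whose squared norm is the probability of the outcome `μ`. -/
noncomputable def teleport {m : ℕ} (ψ φ : (Cube m → ZMod 2) → ℂ) (μ : Cube m → ZMod 2) :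
    (Cube m → ZMod 2) → ℂ :=
  let afterCNOT : (Cube m → ZMod 2) × (Cube m → ZMod 2) → ℂ := fun p => ψ p.1 * φ (p.2 - p.1)
  tensorOp (fun v =>
    if Even (hammingNorm v) then (if μ v = 1 then gateS else 1)
    else (if μ v = 0 then gateSᴴ else 1)) *ᵥ fun x => afterCNOT (x, μ)

end BigUnfolded

/-!
The argument is a computation with polynomials over `𝔽₂` followed by one Walsh sum.

*Stabilizers.* The squarefree monomials `m_S = ∏_{j ∈ S} X_j` form a basis of the words on the cube,
and the coefficient of `m_S` in a word is the sum of the word over the subcube `⟨S⟩`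
(`eq_sum_monomialWord`). A subcube of type `J` has leading monomial `m_{Jᶜ}`, so parallel subcubes
agree up to smaller degree, and a subcube is a sum of parallel subcubes of any smaller type. Hence
the `Z` stabilizer group is spanned by the monomials of degree at most `3` and the twelve
monomials `m_{Jᶜ}` with `J` an extra type; all dimensions are obtained by counting monomials. By the
coefficient formula, the words orthogonal to the `Z` stabilizers are exactly the affine functions
plus combinations of `X₁X₂`, `X₃X₄`, `X₅X₆` (`exists_add_sum_mem_RM_one`), which is what makes the
three pairs of subcubes a complete set of logical operators (`isLogicalBasis_bigUnfolded`).

*Encoders.* For a CSS code with such a set of logical operators, the uniform superpositions over the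
cosets of the `X` stabilizer group in the annihilator of the `Z` stabilizer group define an encoder,
and every encoder sends `|a⟩` to a state supported on the coset labelled by `a`
(`CSSCode.IsLogicalBasis.isEncoder`, `IsEncoder.mem_of_apply_ne_zero`).

*Logical action of `T̃`.* `T̃` multiplies `|x⟩` by `ω^N` with `ω = e^{iπ/4}` and
`N = ∑_v (-1)^{|v|} x_v`. Since `2 x_v = 1 - (-1)^{x_v}`, the number `-2N` is the Walsh sum
`∑_v (-1)^{|v| + x_v}`. For `x` in the coset `a`, it factorizes over the three pairs of coordinates,
with factors `±2` where `a k = 1`, and `0` or `4` where `a k = 0`. So `N` is `4` modulo `8` if all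
`a k` are `1`, and `0` modulo `8` otherwise (`exists_tildeExponent_eq`): this is the phase of `CCZ`.

*Teleportation.* Vertex by vertex, the corrected teleportation with outcome `μ` applies `T` or `T†`
up to a phase that depends on `μ` only, and a `Z` error on `|T⟩` becomes a `Z` error on the code
qubit (`teleport_eq`). A word of weight at most `3` meets some affine function in an odd set, and the
corresponding `X` stabilizer anticommutes with the error.
-/

namespace BigUnfolded

/-! ### Monomials and Reed-Muller codes -/

/-- The word of the squarefree monomial `∏_{j ∈ S} X_j`. -/
def monomialWord {m : ℕ} (S : Finset (Fin m)) : Cube m → ZMod 2 := fun v => ∏ j ∈ S, v j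

/-- The space of words spanned by the squarefree monomials indexed by `F`. -/
def monomialSpan {m : ℕ} (F : Set (Finset (Fin m))) : Submodule (ZMod 2) (Cube m → ZMod 2) :=
  Submodule.span (ZMod 2) (monomialWord '' F)

theorem subcube_apply {m : ℕ} (J : Finset (Fin m)) (v w : Cube m) :
    subcube J v w = ∏ j ∈ Jᶜ, (w j + (v j + 1)) := by
  rw [subcube_eq_evalWord]
  simp [evalWord, map_prod]

theorem monomialWord_eq_subcube {m : ℕ} (S : Finset (Fin m)) :
    monomialWord S = subcube Sᶜ 1 := by
  have h : (1 + 1 : ZMod 2) = 0 := by decide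
  ext w
  simp [subcube_apply, monomialWord, h]

theorem monomialWord_mem_monomialSpan {m : ℕ} {F : Set (Finset (Fin m))} {S : Finset (Fin m)}
    (hS : S ∈ F) : monomialWord S ∈ monomialSpan F :=
  Submodule.subset_span ⟨S, hS, rfl⟩

/-- The Möbius transform: the coefficient of the monomial `S` in a word is the sum of the word
over the subcube `⟨S⟩`. -/
theorem eq_sum_monomialWord {m : ℕ} (x : Cube m → ZMod 2) :
    x = ∑ S, (subcube S 0 ⬝ᵥ x) • monomialWord S := by
  ext v
  have key : ∀ u : Cube m,
      ∑ S, subcube S 0 u * monomialWord S v = if v = u then 1 else 0 := by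
    intro u
    have h1 : subcube ∅ u v = if v = u then 1 else 0 := by
      simp [subcube, funext_iff]
    rw [← h1, subcube_apply, Finset.compl_empty, Finset.prod_add, Finset.powerset_univ]
    refine Finset.sum_congr rfl fun S _ => ?_
    rw [subcube_apply, monomialWord, mul_comm, Finset.compl_eq_univ_sdiff]
    simp
  simp only [Finset.sum_apply, Pi.smul_apply, smul_eq_mul, dotProduct, Finset.sum_mul]
  rw [Finset.sum_comm]
  have : ∀ u, ∑ S, subcube S 0 u * x u * monomialWord S v = if v = u then x u else 0 := by
    intro u
    have := congrArg (x u * ·) (key u)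
    simp only [Finset.mul_sum, mul_ite, mul_one, mul_zero] at this
    rw [← this]
    exact Finset.sum_congr rfl fun S _ => by ring
  simp [this]

/-- The `2 ^ m` monomials span the space of all words, which has dimension `2 ^ m`. -/
theorem linearIndependent_monomialWord {m : ℕ} :
    LinearIndependent (ZMod 2) (monomialWord : Finset (Fin m) → Cube m → ZMod 2) := by
  refine linearIndependent_of_top_le_span_of_card_eq_finrank (fun x _ => ?_) ?_
  · rw [eq_sum_monomialWord x]
    exact Submodule.sum_mem _ fun S _ =>
      Submodule.smul_mem _ _ (Submodule.subset_span ⟨S, rfl⟩)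
  · simp [ZMod.card]

theorem finrank_monomialSpan {m : ℕ} (F : Finset (Finset (Fin m))) :
    Module.finrank (ZMod 2) (monomialSpan (F : Set (Finset (Fin m)))) = F.card := by
  have h := linearIndependent_monomialWord (m := m)
  have h2 : LinearIndependent (ZMod 2) (fun S : F => monomialWord (S : Finset (Fin m))) :=
    h.comp _ Subtype.val_injective
  have := finrank_span_eq_card h2
  rw [monomialSpan, Set.image_eq_range]
  simpa using this

/-- Since `b ^ n = b` in `𝔽₂` for `n ≠ 0`, every polynomial may be replaced by a squarefree one. -/
theorem RM_eq_monomialSpan (m r : ℕ) : RM m r = monomialSpan {S | S.card ≤ r} := by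
  apply le_antisymm
  · rintro _ ⟨P, hP, rfl⟩
    rw [SetLike.mem_coe, MvPolynomial.mem_restrictTotalDegree] at hP
    rw [P.as_sum, map_sum]
    refine Submodule.sum_mem _ fun d hd => ?_
    have hd' : d.support.card ≤ r := by
      refine le_trans ?_ ((MvPolynomial.le_totalDegree hd).trans hP)
      rw [Finset.card_eq_sum_ones]
      exact Finset.sum_le_sum fun j hj => Nat.one_le_iff_ne_zero.2 (Finsupp.mem_support_iff.1 hj)
    have : evalWord m (MvPolynomial.monomial d (P.coeff d)) =
        P.coeff d • monomialWord d.support := by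
      have hpow : ∀ (b : ZMod 2) (n : ℕ), n ≠ 0 → b ^ n = b := by
        intro b n hn
        rcases (by decide : ∀ b : ZMod 2, b = 0 ∨ b = 1) b with rfl | rfl
        · exact zero_pow hn
        · exact one_pow n
      ext v
      simp only [evalWord, LinearMap.coe_mk, AddHom.coe_mk, MvPolynomial.eval_monomial,
        Finsupp.prod, monomialWord, Pi.smul_apply, smul_eq_mul]
      congr 1
      exact Finset.prod_congr rfl fun j hj => hpow _ _ (Finsupp.mem_support_iff.1 hj)
    rw [this]
    exact Submodule.smul_mem _ _ (monomialWord_mem_monomialSpan hd')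
  · refine Submodule.span_le.2 ?_
    rintro _ ⟨S, hS, rfl⟩
    rw [monomialWord_eq_subcube]
    refine subcube_mem_RM _ _ _ ?_
    have := Finset.card_add_card_compl S
    have hS : S.card ≤ r := hS
    simp only [Fintype.card_fin] at this
    omega

/-- The leading monomial of a subcube of type `J` is `∏_{j ∉ J} X_j`. -/
theorem subcube_sub_monomialWord_mem_RM {m : ℕ} (J : Finset (Fin m)) (v : Cube m) (r : ℕ)
    (h : Jᶜ.card ≤ r + 1) : subcube J v - monomialWord Jᶜ ∈ RM m r := by
  have : subcube J v - monomialWord Jᶜ =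
      ∑ S ∈ Jᶜ.powerset.erase Jᶜ, (∏ j ∈ Jᶜ \ S, (v j + 1)) • monomialWord S := by
    rw [sub_eq_iff_eq_add']
    ext w
    rw [subcube_apply, Finset.prod_add,
      ← Finset.add_sum_erase _ _ (Finset.mem_powerset_self Jᶜ)]
    simp [monomialWord, mul_comm]
  rw [this, RM_eq_monomialSpan]
  refine Submodule.sum_mem _ fun S hS =>
    Submodule.smul_mem _ _ (monomialWord_mem_monomialSpan ?_)
  rw [Finset.mem_erase, Finset.mem_powerset] at hS
  have := Finset.card_lt_card (hS.2.ssubset_of_ne hS.1)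
  simp only [Set.mem_ofPred_eq]
  omega

/-- Parallel subcubes agree up to words of smaller degree. -/
theorem subcube_sub_subcube_mem_RM {m : ℕ} (J : Finset (Fin m)) (v w : Cube m) (r : ℕ)
    (h : Jᶜ.card ≤ r + 1) : subcube J v - subcube J w ∈ RM m r := by
  have := Submodule.sub_mem _ (subcube_sub_monomialWord_mem_RM J v r h)
    (subcube_sub_monomialWord_mem_RM J w r h)
  simpa using this

/-- A subcube splits into two halves along each of its directions. -/
theorem subcube_insert {m : ℕ} {J : Finset (Fin m)} {j : Fin m} (hj : j ∉ J) (v : Cube m) :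
    subcube (insert j J) v = subcube J v + subcube J (Function.update v j (v j + 1)) := by
  ext w
  have hc : Jᶜ = insert j (insert j J)ᶜ := by
    ext i; by_cases h : i = j <;> simp_all
  have hj' : j ∉ (insert j J)ᶜ := by simp
  have key : ∀ a b : ZMod 2, a + (b + 1) + (a + (b + 1 + 1)) = 1 := by decide
  have hP : ∏ i ∈ (insert j J)ᶜ, (w i + (Function.update v j (v j + 1) i + 1)) =
      ∏ i ∈ (insert j J)ᶜ, (w i + (v i + 1)) :=
    Finset.prod_congr rfl fun i hi => by
      rw [Function.update_of_ne (by rintro rfl; exact hj' hi)]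
  simp only [Pi.add_apply, subcube_apply]
  rw [hc, Finset.prod_insert hj', Finset.prod_insert hj', hP, Function.update_self, ← add_mul,
    key, one_mul]

/-- A subcube of type `K` is a sum of subcubes of any type `J ⊆ K`. -/
theorem subcube_mem_of_subset {m : ℕ} {M : Submodule (ZMod 2) (Cube m → ZMod 2)}
    {J K : Finset (Fin m)} (hJK : J ⊆ K) (h : ∀ v, subcube J v ∈ M) (v : Cube m) :
    subcube K v ∈ M := by
  obtain ⟨D, hD, rfl⟩ : ∃ D, Disjoint J D ∧ K = D ∪ J :=
    ⟨K \ J, Finset.disjoint_sdiff, by rw [Finset.sdiff_union_of_subset hJK]⟩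
  clear hJK hD
  induction D using Finset.induction_on generalizing v with
  | empty => simpa using h v
  | insert j D _ ih =>
    rw [Finset.insert_union]
    by_cases hj : j ∈ D ∪ J
    · rw [Finset.insert_eq_of_mem hj]; exact ih v
    · rw [subcube_insert hj]
      exact Submodule.add_mem _ (ih _) (ih _)

/-! ### The stabilizer groups of the big unfolded code -/

instance : DecidablePred (· ∈ extraTypes) := fun J =>
  inferInstanceAs (Decidable (J.card = 2 ∧ ∀ k, J ≠ logicalType k))

theorem exists_extraType_subset (K : Finset (Fin 6)) :
    2 ≤ K.card → (∀ k, K ≠ logicalType k) → ∃ J ∈ extraTypes, J ⊆ K := by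
  revert K
  decide +kernel

theorem subcube_mem_Subcubes_extraTypes {K : Finset (Fin 6)} (h2 : 2 ≤ K.card)
    (hK : ∀ k, K ≠ logicalType k) (v : Cube 6) : subcube K v ∈ Subcubes extraTypes := by
  obtain ⟨J, hJ, hJK⟩ := exists_extraType_subset K h2 hK
  have hM : ∀ w, subcube J w ∈ Subcubes extraTypes := fun w =>
    Submodule.subset_span ⟨J, hJ, w, rfl⟩
  exact subcube_mem_of_subset hJK hM v

theorem card_logicalType (k : Fin 3) : (logicalType k).card = 2 := by
  revert k; decide

/-- A monomial of degree at most `3` is a subcube of dimension at least `3`, and every set of three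
coordinates contains an extra type. -/
theorem RM_three_le_Subcubes : RM 6 3 ≤ Subcubes extraTypes := by
  rw [RM_eq_monomialSpan]
  refine Submodule.span_le.2 ?_
  rintro _ ⟨S, hS, rfl⟩
  have hS : S.card ≤ 3 := hS
  have hc := Finset.card_add_card_compl S
  simp only [Fintype.card_fin] at hc
  rw [monomialWord_eq_subcube]
  refine subcube_mem_Subcubes_extraTypes (by omega) (fun k hk => ?_) 1
  have := card_logicalType k
  rw [← hk] at this
  omega

/-- Modulo `RM₆(3)`, a square depends only on its type. -/
theorem Subcubes_extraTypes_eq (c : Finset (Fin 6) → Cube 6) :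
    Subcubes extraTypes =
      RM 6 3 ⊔ Submodule.span (ZMod 2) {w | ∃ J ∈ extraTypes, w = subcube J (c J)} := by
  apply le_antisymm
  · refine Submodule.span_le.2 ?_
    rintro _ ⟨J, hJ, v, rfl⟩
    have hcard : Jᶜ.card ≤ 3 + 1 := by rw [Finset.card_compl, hJ.1]; decide
    rw [← sub_add_cancel (subcube J v) (subcube J (c J))]
    exact Submodule.add_mem_sup (subcube_sub_subcube_mem_RM J v (c J) 3 hcard)
      (Submodule.subset_span ⟨J, hJ, rfl⟩)
  · refine sup_le RM_three_le_Subcubes (Submodule.span_le.2 ?_)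
    rintro _ ⟨J, hJ, rfl⟩
    exact Submodule.subset_span ⟨J, hJ, c J, rfl⟩

theorem Subcubes_extraTypes_eq_monomialSpan :
    Subcubes extraTypes =
      monomialSpan {S : Finset (Fin 6) | S.card ≤ 3 ∨ Sᶜ ∈ extraTypes} := by
  rw [Subcubes_extraTypes_eq 1, RM_eq_monomialSpan, monomialSpan, monomialSpan,
    ← Submodule.span_union]
  congr 1
  ext w
  simp only [Set.mem_union, Set.mem_image, Set.mem_ofPred_eq]
  constructor
  · rintro (⟨S, hS, rfl⟩ | ⟨J, hJ, rfl⟩)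
    · exact ⟨S, Or.inl hS, rfl⟩
    · exact ⟨Jᶜ, Or.inr (by rwa [compl_compl]), by
        rw [monomialWord_eq_subcube, compl_compl, Pi.one_apply]⟩
  · rintro ⟨S, hS | hS, rfl⟩
    · exact Or.inl ⟨S, hS, rfl⟩
    · exact Or.inr ⟨Sᶜ, hS, monomialWord_eq_subcube S⟩

theorem finrank_RM_six_three : Module.finrank (ZMod 2) (RM 6 3) = 42 := by
  have := finrank_monomialSpan (Finset.univ.filter fun S : Finset (Fin 6) => S.card ≤ 3)
  rw [Finset.coe_filter_univ, ← RM_eq_monomialSpan] at this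
  rw [this]
  decide +kernel

theorem finrank_Subcubes_extraTypes :
    Module.finrank (ZMod 2) (Subcubes extraTypes) = 54 := by
  have := finrank_monomialSpan
    (Finset.univ.filter fun S : Finset (Fin 6) => S.card ≤ 3 ∨ Sᶜ ∈ extraTypes)
  rw [Finset.coe_filter_univ, ← Subcubes_extraTypes_eq_monomialSpan] at this
  rw [this]
  decide +kernel

theorem ncard_extraTypes : extraTypes.ncard = 12 := by
  have h : extraTypes = ↑(Finset.univ.filter fun J : Finset (Fin 6) => J ∈ extraTypes) := by
    rw [Finset.coe_filter_univ]; rfl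
  rw [h, Set.ncard_coe_finset]
  decide +kernel

theorem zStab_QRM_six : (QRM 6 1 2 (by norm_num)).zStab = RM 6 3 := by
  simp [QRM]

/-! ### Signs and Pauli operators -/

/-- The character `b ↦ (-1)^b` of `𝔽₂`. -/
def sign (b : ZMod 2) : ℤ := if b = 0 then 1 else -1

@[simp] theorem sign_zero : sign 0 = 1 := rfl

@[simp] theorem sign_one : sign 1 = -1 := rfl

theorem zmod_two_cases : ∀ b : ZMod 2, b = 0 ∨ b = 1 := by decide

theorem sign_add : ∀ a b : ZMod 2, sign (a + b) = sign a * sign b := by decide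

theorem sign_sum {α : Type*} (s : Finset α) (f : α → ZMod 2) :
    sign (∑ i ∈ s, f i) = ∏ i ∈ s, sign (f i) := by
  classical
  induction s using Finset.induction_on with
  | empty => simp
  | insert i s hi ih => rw [Finset.sum_insert hi, Finset.prod_insert hi, sign_add, ih]

theorem word_add_self {ι : Type*} (x : ι → ZMod 2) : x + x = 0 :=
  funext fun i => CharTwo.add_self_eq_zero (x i)

theorem word_add_eq_iff {ι : Type*} {x y z : ι → ZMod 2} : x + y = z ↔ x = z + y := by
  constructor <;> rintro rfl <;> rw [add_assoc, word_add_self, add_zero]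

variable {ι : Type} [Fintype ι]

theorem opX_apply (V x y : ι → ZMod 2) : opX V x y = if y = x + V then 1 else 0 := by
  have key : ∀ a b c : ZMod 2,
      (if a = 1 then gateX else 1) b c = if c = b + a then (1 : ℂ) else 0 := by
    intro a b c
    rcases zmod_two_cases a with rfl | rfl <;> rcases zmod_two_cases b with rfl | rfl <;>
      rcases zmod_two_cases c with rfl | rfl <;>
      simp [gateX, show (1 + 1 : ZMod 2) = 0 by decide]
  simp only [opX, tensorOp, Matrix.of_apply, key, Finset.prod_ite_zero]
  simp [funext_iff]

theorem tensorOp_diagonal (d : ι → ZMod 2 → ℂ) :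
    tensorOp (fun v => Matrix.diagonal (d v)) = Matrix.diagonal fun x => ∏ v, d v (x v) := by
  ext x y
  simp only [tensorOp, Matrix.of_apply, Matrix.diagonal_apply, Finset.prod_ite_zero]
  simp [funext_iff]

theorem opZ_eq (V : ι → ZMod 2) :
    opZ V = Matrix.diagonal fun x => ((sign (V ⬝ᵥ x) : ℤ) : ℂ) := by
  have : ∀ v, (if V v = 1 then gateZ else 1) =
      Matrix.diagonal fun b => ((sign (V v * b) : ℤ) : ℂ) := by
    intro v
    rcases zmod_two_cases (V v) with h | h
    · simp [h]
    · simp [h, gateZ, sign, apply_ite]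
  simp only [opZ, this, tensorOp_diagonal, dotProduct, sign_sum, Int.cast_prod]

section

variable [DecidableEq ι]

theorem opX_mulVec (V : ι → ZMod 2) (ψ : (ι → ZMod 2) → ℂ) (x : ι → ZMod 2) :
    (opX V *ᵥ ψ) x = ψ (x + V) := by
  simp [Matrix.mulVec, dotProduct, opX_apply]

theorem opX_mul_apply {κ : Type} (V : ι → ZMod 2) (M : Matrix (ι → ZMod 2) κ ℂ)
    (x : ι → ZMod 2) (a : κ) : (opX V * M) x a = M (x + V) a := by
  simp [Matrix.mul_apply, opX_apply]

theorem mul_opX_apply {κ : Type} (V : ι → ZMod 2) (M : Matrix κ (ι → ZMod 2) ℂ)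
    (x : κ) (a : ι → ZMod 2) : (M * opX V) x a = M x (a + V) := by
  have : ∀ y, a = y + V ↔ y = a + V := fun y => by
    rw [← word_add_eq_iff]; exact eq_comm
  simp [Matrix.mul_apply, opX_apply, this]

theorem opX_add (V W : ι → ZMod 2) : opX (V + W) = opX V * opX W := by
  ext x y
  rw [opX_mul_apply, opX_apply, opX_apply, add_assoc]

theorem opZ_add (V W : ι → ZMod 2) : opZ (V + W) = opZ V * opZ W := by
  simp [opZ_eq, add_dotProduct, sign_add]

/-- `X(s)` and `Z(e)` anticommute when their supports meet in an odd set. -/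
theorem opX_mul_opZ_of_dotProduct_eq_one {s e : ι → ZMod 2} (h : e ⬝ᵥ s = 1) :
    opX s * opZ e = -(opZ e * opX s) := by
  ext x y
  rw [opX_mul_apply, opZ_eq, Matrix.neg_apply, Matrix.diagonal_mul, Matrix.diagonal_apply,
    opX_apply, dotProduct_add, sign_add, h]
  by_cases hy : y = x + s <;> simp [hy, eq_comm]

end

/-! ### Encoders of CSS codes -/

theorem sum_add_single {κ : Type*} {n : ℕ} (lx : Fin n → κ → ZMod 2) (a : Fin n → ZMod 2)
    (k : Fin n) : ∑ l, (a + Pi.single k 1 : Fin n → ZMod 2) l • lx l = ∑ l, a l • lx l + lx k := by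
  simp [add_smul, Finset.sum_add_distrib, Pi.single_apply]

/-- Code states are invariant under translation by `X` stabilizers and supported on the words
orthogonal to the `Z` stabilizers. -/
theorem CSSCode.mem_codeSpace_iff [DecidableEq ι] {C : CSSCode ι} {ψ : (ι → ZMod 2) → ℂ} :
    ψ ∈ C.codeSpace ↔ (∀ s ∈ C.xStab, ∀ x, ψ (x + s) = ψ x) ∧
      ∀ x, ψ x ≠ 0 → ∀ b ∈ C.zStab, b ⬝ᵥ x = 0 := by
  change ((∀ a ∈ C.xStab, opX a *ᵥ ψ = ψ) ∧ ∀ b ∈ C.zStab, opZ b *ᵥ ψ = ψ) ↔ _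
  simp only [funext_iff, opX_mulVec, opZ_eq, Matrix.mulVec_diagonal]
  refine and_congr_right fun _ => ⟨fun h x hx b hb => ?_, fun h b hb x => ?_⟩
  · have := h b hb x
    rcases zmod_two_cases (b ⬝ᵥ x) with h0 | h1
    · exact h0
    · rw [h1] at this
      simp only [sign_one, Int.cast_neg, Int.cast_one, neg_one_mul] at this
      exact absurd (CharZero.neg_eq_self_iff.1 this) hx
  · by_cases hx : ψ x = 0
    · simp [hx]
    · simp [h x hx b hb]

/-- The words `lx` and `lz` describe conjugate logical Pauli operators of the CSS code `C`, and the
code has no further logical qubits: every word orthogonal to the `Z` stabilizers is a combination of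
the words `lx` up to an `X` stabilizer. -/
structure CSSCode.IsLogicalBasis (C : CSSCode ι) {n : ℕ} (lx lz : Fin n → ι → ZMod 2) : Prop where
  lx_orth : ∀ k, ∀ b ∈ C.zStab, b ⬝ᵥ lx k = 0
  lz_orth : ∀ k, ∀ s ∈ C.xStab, lz k ⬝ᵥ s = 0
  pairing : ∀ k l, lz k ⬝ᵥ lx l = if k = l then 1 else 0
  complete : ∀ x, (∀ b ∈ C.zStab, b ⬝ᵥ x = 0) → ∃ a : Fin n → ZMod 2, x + ∑ k, a k • lx k ∈ C.xStab

namespace CSSCode.IsLogicalBasis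

variable {C : CSSCode ι} {n : ℕ} {lx lz : Fin n → ι → ZMod 2}

theorem orth_of_mem (h : C.IsLogicalBasis lx lz) {x : ι → ZMod 2} {a : Fin n → ZMod 2}
    (hx : x + ∑ k, a k • lx k ∈ C.xStab) {b : ι → ZMod 2} (hb : b ∈ C.zStab) : b ⬝ᵥ x = 0 := by
  have := C.comm _ hx b hb
  rw [dotProduct_comm, dotProduct_add, dotProduct_sum] at this
  simpa [h.lx_orth _ b hb] using this

/-- The coset of `xStab` that contains `x` is read off from the values of the logical operators. -/
theorem lz_dotProduct_of_mem (h : C.IsLogicalBasis lx lz) {x : ι → ZMod 2} {a : Fin n → ZMod 2}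
    (hx : x + ∑ k, a k • lx k ∈ C.xStab) (k : Fin n) : lz k ⬝ᵥ x = a k := by
  have := h.lz_orth k _ hx
  rw [dotProduct_add, dotProduct_sum] at this
  simp only [dotProduct_smul, h.pairing, smul_eq_mul, mul_ite, mul_one, mul_zero,
    Finset.sum_ite_eq, Finset.mem_univ, if_true] at this
  exact CharTwo.add_eq_zero.1 this

theorem eq_of_mem (h : C.IsLogicalBasis lx lz) {x : ι → ZMod 2} {a b : Fin n → ZMod 2}
    (ha : x + ∑ k, a k • lx k ∈ C.xStab) (hb : x + ∑ k, b k • lx k ∈ C.xStab) : a = b :=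
  funext fun k => (h.lz_dotProduct_of_mem ha k).symm.trans (h.lz_dotProduct_of_mem hb k)

variable [DecidableEq ι]

open Classical in
/-- The standard encoder: the logical basis state `|a⟩` is sent to the normalized sum of the basis
states in the coset `∑ k, a k • lx k + xStab`. -/
noncomputable def encoder (C : CSSCode ι) (lx : Fin n → ι → ZMod 2) :
    Matrix (ι → ZMod 2) (Fin n → ZMod 2) ℂ :=
  Matrix.of fun x a =>
    if x + ∑ k, a k • lx k ∈ C.xStab then ((1 / Real.sqrt (Nat.card C.xStab) : ℝ) : ℂ) else 0

theorem isEncoder (h : C.IsLogicalBasis lx lz) : IsEncoder C lx lz (encoder C lx) := by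
  classical
  set c : ℝ := 1 / Real.sqrt (Nat.card C.xStab) with hc
  have hcard : (0 : ℝ) < Nat.card C.xStab := by exact_mod_cast Nat.card_pos
  have hc0 : (c : ℂ) ≠ 0 := by
    rw [Complex.ofReal_ne_zero, hc]
    positivity
  have hE : ∀ x a, encoder C lx x a = if x + ∑ k, a k • lx k ∈ C.xStab then (c : ℂ) else 0 :=
    fun x a => rfl
  have hcol : ∀ a, (fun x => encoder C lx x a) ∈ C.codeSpace := by
    intro a
    refine CSSCode.mem_codeSpace_iff.2 ⟨fun s hs x => ?_, fun x hx b hb => ?_⟩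
    · simp only [hE]
      rw [add_right_comm, Submodule.add_mem_iff_left _ hs]
    · refine h.orth_of_mem (a := a) ?_ hb
      by_contra hx'
      exact hx (by simp [hE, hx'])
  refine ⟨?_, ?_, ?_, ?_⟩
  · -- the columns are supported on disjoint cosets, each with `Nat.card C.xStab` elements
    ext a b
    rw [Matrix.mul_apply, Matrix.one_apply]
    split_ifs with hab
    · subst hab
      have h1 : ∀ x, star (encoder C lx x a) * encoder C lx x a =
          if x + ∑ k, a k • lx k ∈ C.xStab then ((c * c : ℝ) : ℂ) else 0 := by
        intro x
        rw [hE]; split_ifs <;> simp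
      simp only [Matrix.conjTranspose_apply, h1]
      rw [← Equiv.sum_comp (Equiv.addRight (∑ k, a k • lx k))]
      have h2 : ∀ x : ι → ZMod 2, x + ∑ k, a k • lx k + ∑ k, a k • lx k = x := fun x => by
        rw [add_assoc, word_add_self, add_zero]
      simp only [Equiv.coe_addRight, h2]
      rw [← Finset.sum_filter, Finset.sum_const, nsmul_eq_mul]
      have h3 : (Finset.univ.filter fun x => x ∈ C.xStab).card = Nat.card C.xStab := by
        rw [Nat.card_eq_fintype_card, Fintype.card_subtype]
      rw [h3, hc]
      norm_cast
      rw [div_mul_div_comm, one_mul, Real.mul_self_sqrt hcard.le]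
      field_simp
    · refine Finset.sum_eq_zero fun x _ => ?_
      rw [Matrix.conjTranspose_apply, hE, hE]
      split_ifs with h1 h2
      · exact absurd (h.eq_of_mem h1 h2) hab
      all_goals simp
  · apply le_antisymm
    · rintro _ ⟨φ, rfl⟩
      have : encoder C lx *ᵥ φ = ∑ a, φ a • fun x => encoder C lx x a := by
        ext x
        simp [Matrix.mulVec, dotProduct, mul_comm]
      rw [Matrix.mulVecLin_apply, this]
      exact Submodule.sum_mem _ fun a _ => Submodule.smul_mem _ _ (hcol a)
    · intro ψ hψ
      rw [CSSCode.mem_codeSpace_iff] at hψ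
      -- a code state is constant on every coset, hence determined by its values at the
      -- representatives `∑ k, a k • lx k`
      refine ⟨fun a => ψ (∑ k, a k • lx k) / c, ?_⟩
      ext x
      simp only [Matrix.mulVecLin_apply, Matrix.mulVec, dotProduct, hE]
      by_cases hx : ∀ b ∈ C.zStab, b ⬝ᵥ x = 0
      · obtain ⟨a, ha⟩ := h.complete x hx
        rw [Finset.sum_eq_single a, if_pos ha, mul_div_cancel₀ _ hc0,
          ← hψ.1 _ ha (∑ k, a k • lx k)]
        · congr 1
          rw [add_comm, add_assoc, word_add_self, add_zero]
        · intro b _ hb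
          rw [if_neg fun hb' => hb (h.eq_of_mem hb' ha), zero_mul]
        · simp
      · rw [Finset.sum_eq_zero]
        · by_contra h0
          exact hx (hψ.2 x (Ne.symm h0))
        · intro a _
          rw [if_neg fun ha => hx fun b hb => h.orth_of_mem ha hb, zero_mul]
  · intro k
    ext x a
    rw [opX_mul_apply, mul_opX_apply, hE, hE, sum_add_single]
    congr 2
    abel
  · intro k
    ext x a
    rw [opZ_eq, opZ_eq, Matrix.diagonal_mul, Matrix.mul_diagonal, hE]
    split_ifs with hx
    · simp [h.lz_dotProduct_of_mem hx, mul_comm]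
    · simp

end CSSCode.IsLogicalBasis

namespace IsEncoder

variable [DecidableEq ι] {C : CSSCode ι} {n : ℕ} {lx lz : Fin n → ι → ZMod 2}
  {E : Matrix (ι → ZMod 2) (Fin n → ZMod 2) ℂ}

theorem mulVec_mem (hE : IsEncoder C lx lz E) (φ : (Fin n → ZMod 2) → ℂ) :
    E *ᵥ φ ∈ C.codeSpace := by
  rw [← hE.range_eq]
  exact ⟨φ, rfl⟩

theorem col_mem (hE : IsEncoder C lx lz E) (a : Fin n → ZMod 2) :
    (fun x => E x a) ∈ C.codeSpace := by
  have := hE.mulVec_mem (Pi.single a 1)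
  rwa [Matrix.mulVec_single_one] at this

theorem finrank_codeSpace (hE : IsEncoder C lx lz E) :
    Module.finrank ℂ C.codeSpace = 2 ^ n := by
  have hinj : Function.Injective E.mulVecLin := by
    intro φ φ' h
    have := congrArg (Eᴴ *ᵥ ·) h
    simpa [Matrix.mulVec_mulVec, hE.isometry] using this
  rw [← hE.range_eq, LinearMap.finrank_range_of_inj hinj]
  simp [ZMod.card]

theorem opX_mul (hE : IsEncoder C lx lz E) {s : ι → ZMod 2} (hs : s ∈ C.xStab) :
    opX s * E = E := by
  ext x a
  rw [opX_mul_apply]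
  exact (CSSCode.mem_codeSpace_iff.1 (hE.col_mem a)).1 s hs x

theorem opZ_mul (hE : IsEncoder C lx lz E) {b : ι → ZMod 2} (hb : b ∈ C.zStab) :
    opZ b * E = E := by
  ext x a
  rw [opZ_eq, Matrix.diagonal_mul]
  by_cases h0 : E x a = 0
  · simp [h0]
  · simp [(CSSCode.mem_codeSpace_iff.1 (hE.col_mem a)).2 x h0 b hb]

/-- A logical `X` operator may be multiplied by `X` stabilizers. -/
theorem opX_mul_of_sub_mem (hE : IsEncoder C lx lz E) {V : ι → ZMod 2} {k : Fin n}
    (h : V - lx k ∈ C.xStab) : opX V * E = E * opX (Pi.single k 1) := by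
  rw [← add_sub_cancel (lx k) V, opX_add, Matrix.mul_assoc, hE.opX_mul h, hE.logicalX]

/-- A logical `Z` operator may be multiplied by `Z` stabilizers. -/
theorem opZ_mul_of_sub_mem (hE : IsEncoder C lx lz E) {V : ι → ZMod 2} {k : Fin n}
    (h : V - lz k ∈ C.zStab) : opZ V * E = E * opZ (Pi.single k 1) := by
  rw [← add_sub_cancel (lz k) V, opZ_add, Matrix.mul_assoc, hE.opZ_mul h, hE.logicalZ]

/-- An encoded basis state `|a⟩` is supported on the coset `∑ k, a k • lx k + xStab`. -/
theorem mem_of_apply_ne_zero (hE : IsEncoder C lx lz E) (h : C.IsLogicalBasis lx lz)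
    {x : ι → ZMod 2} {a : Fin n → ZMod 2} (hx : E x a ≠ 0) :
    x + ∑ k, a k • lx k ∈ C.xStab := by
  obtain ⟨b, hb⟩ := h.complete x ((CSSCode.mem_codeSpace_iff.1 (hE.col_mem a)).2 x hx)
  suffices b = a by rwa [← this]
  ext k
  have := congrFun (congrFun (hE.logicalZ k) x) a
  rw [opZ_eq, opZ_eq, Matrix.diagonal_mul, Matrix.mul_diagonal, h.lz_dotProduct_of_mem hb,
    mul_comm, mul_right_inj' hx, single_one_dotProduct] at this
  have inj : ∀ p q : ZMod 2, sign p = sign q → p = q := by decide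
  exact inj _ _ (by exact_mod_cast this)

end IsEncoder

/-! ### Words orthogonal to the `Z` stabilizers -/

/-- Two subcubes with a common direction meet in an even number of vertices. -/
theorem subcube_dotProduct_subcube_eq_zero {m : ℕ} {J K : Finset (Fin m)} {j : Fin m}
    (hJ : j ∈ J) (hK : j ∈ K) (v w : Cube m) : subcube J v ⬝ᵥ subcube K w = 0 := by
  have h : ∀ (L : Finset (Fin m)) (u x : Cube m), j ∈ L →
      subcube L u (Function.update x j (x j + 1)) = subcube L u x := by
    intro L u x hL
    simp only [subcube_apply]
    refine Finset.prod_congr rfl fun i hi => ?_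
    rw [Function.update_of_ne]
    rintro rfl
    exact Finset.mem_compl.1 hi hL
  have hne : ∀ b : ZMod 2, b + 1 ≠ b := by decide
  refine Finset.sum_involution (fun x _ => Function.update x j (x j + 1)) ?_ ?_ ?_ ?_
  · intro x _
    rw [h J v x hJ, h K w x hK, CharTwo.add_self_eq_zero]
  · intro x _ _ hx
    have := congrFun hx j
    rw [Function.update_self] at this
    exact hne _ this
  · intro x _
    exact Finset.mem_univ _
  · intro x _
    rw [Function.update_self, Function.update_idem, add_assoc, CharTwo.add_self_eq_zero, add_zero,
      Function.update_eq_self]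

theorem dotProduct_eq_zero_of_mem_Subcubes {m : ℕ} {𝒯 : Set (Finset (Fin m))}
    {x b : Cube m → ZMod 2} (h : ∀ J ∈ 𝒯, ∀ v, x ⬝ᵥ subcube J v = 0) (hb : b ∈ Subcubes 𝒯) :
    x ⬝ᵥ b = 0 := by
  induction hb using Submodule.span_induction with
  | mem y hy =>
    obtain ⟨J, hJ, v, rfl⟩ := hy
    exact h J hJ v
  | zero => exact dotProduct_zero x
  | add y z _ _ hy hz => rw [dotProduct_add, hy, hz, add_zero]
  | smul t y _ hy => rw [dotProduct_smul, hy, smul_zero]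

theorem logicalType_card_compl_le (k : Fin 3) : (logicalType k)ᶜᶜ.card ≤ 1 + 1 := by
  rw [compl_compl, card_logicalType]

theorem subcube_compl_logicalType_sub_mem (k : Fin 3) (v w : Cube 6) :
    subcube (logicalType k)ᶜ v - subcube (logicalType k)ᶜ w ∈ RM 6 1 :=
  subcube_sub_subcube_mem_RM _ v w 1 (logicalType_card_compl_le k)

theorem subcube_logicalType_sub_mem (k : Fin 3) (v w : Cube 6) :
    subcube (logicalType k) v - subcube (logicalType k) w ∈ Subcubes extraTypes :=
  RM_three_le_Subcubes (subcube_sub_subcube_mem_RM _ v w 3 (by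
    rw [Finset.card_compl, card_logicalType]; decide))

/-- A word orthogonal to all `Z` stabilizers has degree at most `2`, and its quadratic part only
involves the products `X₁X₂`, `X₃X₄`, `X₅X₆`. -/
theorem exists_add_sum_mem_RM_one {x : Cube 6 → ZMod 2}
    (hx : ∀ b ∈ Subcubes extraTypes, b ⬝ᵥ x = 0) :
    ∃ a : Fin 3 → ZMod 2, x + ∑ k, a k • subcube (logicalType k)ᶜ 0 ∈ RM 6 1 := by
  have hsup : x ∈ RM 6 1 ⊔
      Submodule.span (ZMod 2) (Set.range fun k => subcube (logicalType k)ᶜ 0) := by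
    rw [eq_sum_monomialWord x]
    refine Submodule.sum_mem _ fun S _ => ?_
    -- for a monomial of degree at least `2` other than the three products, the subcube that
    -- computes its coefficient is a `Z` stabilizer, so that the coefficient vanishes
    by_cases h1 : S.card ≤ 1
    · refine Submodule.mem_sup_left (Submodule.smul_mem _ _ ?_)
      rw [RM_eq_monomialSpan]
      exact monomialWord_mem_monomialSpan h1
    by_cases h2 : ∃ k, S = logicalType k
    · obtain ⟨k, rfl⟩ := h2
      refine Submodule.smul_mem _ _ ?_
      have := subcube_sub_monomialWord_mem_RM (logicalType k)ᶜ 0 1 (logicalType_card_compl_le k)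
      rw [compl_compl] at this
      rw [← sub_sub_cancel (subcube (logicalType k)ᶜ 0) (monomialWord (logicalType k))]
      exact Submodule.sub_mem _ (Submodule.mem_sup_right (Submodule.subset_span ⟨k, rfl⟩))
        (Submodule.mem_sup_left this)
    · push Not at h1 h2
      rw [hx _ (subcube_mem_Subcubes_extraTypes h1 h2 0), zero_smul]
      exact Submodule.zero_mem _
  obtain ⟨r, hr, q, hq, rfl⟩ := Submodule.mem_sup.1 hsup
  obtain ⟨a, rfl⟩ := (Submodule.mem_span_range_iff_exists_fun _).1 hq
  exact ⟨a, by rwa [add_assoc, word_add_self, add_zero]⟩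

theorem subcube_dotProduct_subcube_logicalType (k l : Fin 3) :
    subcube (logicalType k) 0 ⬝ᵥ subcube (logicalType l)ᶜ 0 = if k = l then 1 else 0 := by
  revert k l
  decide +kernel

theorem isLogicalBasis_bigUnfolded :
    bigUnfolded.IsLogicalBasis (fun k => subcube (logicalType k)ᶜ 0)
      (fun k => subcube (logicalType k) 0) where
  lx_orth k b hb := by
    rw [dotProduct_comm]
    refine dotProduct_eq_zero_of_mem_Subcubes (fun J hJ v => ?_) hb
    have hJk : ¬ J ⊆ logicalType k := fun h =>
      hJ.2 k (Finset.eq_of_subset_of_card_le h (by rw [card_logicalType, hJ.1]))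
    obtain ⟨j, hj, hjk⟩ := Finset.not_subset.1 hJk
    exact subcube_dotProduct_subcube_eq_zero (Finset.mem_compl.2 hjk) hj 0 v
  lz_orth k s hs := by
    rw [dotProduct_comm]
    exact RM_orthogonal (by norm_num) hs
      (subcube_mem_RM (m := 6) (logicalType k) 0 4 (by rw [card_logicalType]))
  pairing := subcube_dotProduct_subcube_logicalType
  complete _ := exists_add_sum_mem_RM_one

/-! ### Walsh sums of the logical words -/

/-- The Walsh coefficient of `a (p + 1) (q + 1)` at `(l, l')`: a word that is quadratic on a pair of
coordinates is bent if `a = 1`, and linear if `a = 0`. -/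
def pairSum (a l l' : ZMod 2) : ℤ :=
  ∑ u : Fin 2 → ZMod 2, sign (a * ((u 0 + 1) * (u 1 + 1)) + (l * u 0 + l' * u 1))

theorem pairSum_zero : ∀ l l' : ZMod 2, pairSum 0 l l' = 0 ∨ pairSum 0 l l' = 4 := by decide

theorem pairSum_one : ∀ l l' : ZMod 2, pairSum 1 l l' = 2 ∨ pairSum 1 l l' = -2 := by decide

/-- Splitting the six coordinates into the three pairs factorizes the sum. -/
theorem sum_prod_pairs (g : Fin 3 → (Fin 2 → ZMod 2) → ℤ) :
    ∑ v : Cube 6, ∏ k, g k (fun i => v (finProdFinEquiv (k, i))) = ∏ k, ∑ u, g k u := by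
  rw [Finset.prod_univ_sum, Fintype.piFinset_univ]
  exact Fintype.sum_equiv
    ((Equiv.arrowCongr (finProdFinEquiv (m := 3) (n := 2)).symm (Equiv.refl (ZMod 2))).trans
      (Equiv.curry _ _ _)) _ _ fun v => rfl

theorem subcube_compl_logicalType_apply (k : Fin 3) (v : Cube 6) :
    subcube (logicalType k)ᶜ 0 v =
      (v (finProdFinEquiv (k, (0 : Fin 2))) + 1) * (v (finProdFinEquiv (k, (1 : Fin 2))) + 1) := by
  have : ∀ k, logicalType k =
      {finProdFinEquiv (k, (0 : Fin 2)), finProdFinEquiv (k, (1 : Fin 2))} := by decide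
  have hne : finProdFinEquiv (k, (0 : Fin 2)) ≠ finProdFinEquiv (k, (1 : Fin 2)) := by simp
  rw [subcube_apply, compl_compl, this, Finset.prod_pair hne]
  simp

theorem sum_sign_quadratic (a : Fin 3 → ZMod 2) (c : ZMod 2) (l : Fin 6 → ZMod 2) :
    ∑ v : Cube 6, sign (∑ k, a k * subcube (logicalType k)ᶜ 0 v + (c + ∑ j, l j * v j)) =
      sign c * ∏ k, pairSum (a k) (l (finProdFinEquiv (k, (0 : Fin 2))))
        (l (finProdFinEquiv (k, (1 : Fin 2)))) := by
  simp only [pairSum]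
  rw [← sum_prod_pairs (fun k u => sign (a k * ((u 0 + 1) * (u 1 + 1)) +
    (l (finProdFinEquiv (k, (0 : Fin 2))) * u 0 + l (finProdFinEquiv (k, (1 : Fin 2))) * u 1))),
    Finset.mul_sum]
  refine Finset.sum_congr rfl fun v _ => ?_
  rw [← sign_sum, ← sign_add]
  congr 1
  have : ∑ j, l j * v j = ∑ k : Fin 3, (l (finProdFinEquiv (k, (0 : Fin 2))) *
      v (finProdFinEquiv (k, (0 : Fin 2))) + l (finProdFinEquiv (k, (1 : Fin 2))) *
      v (finProdFinEquiv (k, (1 : Fin 2)))) := by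
    rw [← Equiv.sum_comp (finProdFinEquiv (m := 3) (n := 2)), Fintype.sum_prod_type]
    simp only [Fin.sum_univ_two]
  rw [this, Finset.sum_add_distrib (f := fun k => a k * _)]
  simp only [subcube_compl_logicalType_apply]
  ring

theorem exists_affine_of_mem_RM_one {m : ℕ} {r : Cube m → ZMod 2} (hr : r ∈ RM m 1) :
    ∃ (c : ZMod 2) (l : Fin m → ZMod 2), ∀ v, r v = c + ∑ j, l j * v j := by
  rw [RM_eq_monomialSpan] at hr
  induction hr using Submodule.span_induction with
  | mem x hx =>
    obtain ⟨S, hS, rfl⟩ := hx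
    rcases Nat.le_one_iff_eq_zero_or_eq_one.1 hS with h | h
    · rw [Finset.card_eq_zero] at h
      exact ⟨1, 0, fun v => by simp [monomialWord, h]⟩
    · obtain ⟨j, rfl⟩ := Finset.card_eq_one.1 h
      exact ⟨0, Pi.single j 1, fun v => by simp [monomialWord, Pi.single_apply]⟩
  | zero => exact ⟨0, 0, fun v => by simp⟩
  | add x y _ _ hx hy =>
    obtain ⟨c, l, h⟩ := hx
    obtain ⟨c', l', h'⟩ := hy
    refine ⟨c + c', l + l', fun v => ?_⟩
    simp only [Pi.add_apply, h, h', add_mul, Finset.sum_add_distrib]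
    ring
  | smul t x _ hx =>
    obtain ⟨c, l, h⟩ := hx
    refine ⟨t * c, t • l, fun v => ?_⟩
    simp only [Pi.smul_apply, smul_eq_mul, h, mul_add, Finset.mul_sum, mul_assoc]

/-- The number `(-1)^|v|`, where `|v|` is the Hamming weight. -/
def paritySign {m : ℕ} (v : Cube m) : ℤ := if Even (hammingNorm v) then 1 else -1

theorem paritySign_eq {m : ℕ} (v : Cube m) : paritySign v = sign (∑ j, v j) := by
  have h : (hammingNorm v : ZMod 2) = ∑ j, v j := by
    have : ∀ b : ZMod 2, (if b ≠ 0 then 1 else 0) = b := by decide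
    simp only [hammingNorm, Finset.card_filter, Nat.cast_sum, Nat.cast_ite, Nat.cast_one,
      Nat.cast_zero, this]
  rw [← h, paritySign, sign]
  exact if_congr ZMod.natCast_eq_zero_iff_even.symm rfl rfl

/-- `T̃` multiplies the basis state `|x⟩` by the power of `e^{iπ/4}` with this exponent. -/
def tildeExponent {m : ℕ} (x : Cube m → ZMod 2) : ℤ := ∑ v, paritySign v * ((x v).val : ℤ)

/-- The exponent is half of a Walsh sum, because the parities `(-1)^|v|` add up to `0`. -/
theorem two_mul_tildeExponent (x : Cube 6 → ZMod 2) :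
    2 * tildeExponent x = -∑ v : Cube 6, sign (x v + ∑ j, v j) := by
  have h0 : ∑ v : Cube 6, sign (∑ j, v j) = 0 := by
    have := sum_sign_quadratic 0 0 1
    simpa [Fin.prod_univ_three, show pairSum 0 1 1 = 0 by decide] using this
  have h2 : ∀ b : ZMod 2, 2 * (b.val : ℤ) = 1 - sign b := by decide
  rw [← sub_eq_zero, sub_neg_eq_add, tildeExponent, Finset.mul_sum, ← Finset.sum_add_distrib,
    ← h0]
  refine Finset.sum_congr rfl fun v _ => ?_
  rw [mul_left_comm, h2, paritySign_eq, sign_add]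
  ring

/-- On the coset of `RM₆(1)` labelled by `a`, the phase of `T̃` is that of `CCZ`: each of the three
pairs contributes a Walsh coefficient `±2` if `a k = 1`, and `0` or `4` if `a k = 0`; half of the
product is `4` modulo `8` if and only if all `a k` are `1`. -/
theorem exists_tildeExponent_eq {x : Cube 6 → ZMod 2} {a : Fin 3 → ZMod 2}
    (hx : x + ∑ k, a k • subcube (logicalType k)ᶜ 0 ∈ RM 6 1) :
    ∃ n : ℤ, tildeExponent x = (if ∀ k, a k = 1 then 4 else 0) + 8 * n := by
  obtain ⟨c, l, hr⟩ := exists_affine_of_mem_RM_one hx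
  have hx' : ∀ v : Cube 6, x v + ∑ j, v j =
      ∑ k, a k * subcube (logicalType k)ᶜ 0 v + (c + ∑ j, (l j + 1) * v j) := by
    intro v
    have := hr v
    simp only [Pi.add_apply, Finset.sum_apply, Pi.smul_apply, smul_eq_mul] at this
    simp only [add_mul, one_mul, Finset.sum_add_distrib]
    rw [← add_assoc c, ← this]
    linear_combination
      -CharTwo.add_self_eq_zero (∑ k, a k * subcube (logicalType k)ᶜ 0 v)
  have h := two_mul_tildeExponent x
  simp only [hx'] at h
  rw [sum_sign_quadratic a c fun j => l j + 1, Fin.prod_univ_three] at h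
  have hs : sign c = 1 ∨ sign c = -1 := by
    rcases zmod_two_cases c with rfl | rfl <;> simp
  -- the three Walsh coefficients are `2 n0`, `2 n1`, `2 n2`
  have h4 : ∀ b l l', ∃ n : ℤ, pairSum b l l' = 2 * n ∧ (b = 0 → 2 ∣ n) ∧
      (b = 1 → n = 1 ∨ n = -1) := by
    intro b l l'
    rcases zmod_two_cases b with rfl | rfl
    · rcases pairSum_zero l l' with h | h <;> rw [h]
      · exact ⟨0, by simp⟩
      · exact ⟨2, by simp⟩
    · rcases pairSum_one l l' with h | h <;> rw [h]
      · exact ⟨1, by simp⟩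
      · exact ⟨-1, by simp⟩
  obtain ⟨n0, hn0, hz0, ho0⟩ := h4 (a 0) (l (finProdFinEquiv ((0 : Fin 3), (0 : Fin 2))) + 1)
    (l (finProdFinEquiv ((0 : Fin 3), (1 : Fin 2))) + 1)
  obtain ⟨n1, hn1, hz1, ho1⟩ := h4 (a 1) (l (finProdFinEquiv ((1 : Fin 3), (0 : Fin 2))) + 1)
    (l (finProdFinEquiv ((1 : Fin 3), (1 : Fin 2))) + 1)
  obtain ⟨n2, hn2, hz2, ho2⟩ := h4 (a 2) (l (finProdFinEquiv ((2 : Fin 3), (0 : Fin 2))) + 1)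
    (l (finProdFinEquiv ((2 : Fin 3), (1 : Fin 2))) + 1)
  rw [hn0, hn1, hn2] at h
  have hN : tildeExponent x = -(sign c * (4 * (n0 * n1 * n2))) := by linarith
  split_ifs with hall
  · have hprod : sign c * (n0 * n1 * n2) = 1 ∨ sign c * (n0 * n1 * n2) = -1 := by
      rcases hs with h | h <;> rcases ho0 (hall 0) with h0 | h0 <;>
        rcases ho1 (hall 1) with h1 | h1 <;> rcases ho2 (hall 2) with h2 | h2 <;>
        simp [h, h0, h1, h2]
    rcases hprod with h | h
    · exact ⟨-1, by rw [hN]; linarith⟩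
    · exact ⟨0, by rw [hN]; linarith⟩
  · have hdvd : (2 : ℤ) ∣ n0 * n1 * n2 := by
      push Not at hall
      obtain ⟨k, hk⟩ := hall
      have hk := (zmod_two_cases (a k)).resolve_right hk
      fin_cases k
      · exact ((hz0 hk).mul_right _).mul_right _
      · exact ((hz1 hk).mul_left _).mul_right _
      · exact (hz2 hk).mul_left _
    obtain ⟨n, hn⟩ := hdvd
    exact ⟨-(sign c * n), by rw [hN, hn]; ring⟩

/-! ### The operator `T̃` and gate teleportation -/

/-- The primitive eighth root of unity `e^{iπ/4}`, the phase of the gate `T`. -/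
noncomputable def tPhase : ℂ := Complex.exp (Complex.I * (Real.pi / 4))

theorem tPhase_ne_zero : tPhase ≠ 0 := Complex.exp_ne_zero _

theorem norm_tPhase : ‖tPhase‖ = 1 := by
  have : tPhase = Complex.exp (((Real.pi / 4 : ℝ) : ℂ) * Complex.I) := by
    rw [tPhase]; push_cast; rw [mul_comm]
  rw [this, Complex.norm_exp_ofReal_mul_I]

theorem tPhase_sq : tPhase ^ 2 = Complex.I := by
  rw [tPhase, ← Complex.exp_nat_mul]
  convert Complex.exp_pi_div_two_mul_I using 2
  push_cast
  ring

theorem star_tPhase : star tPhase = tPhase⁻¹ := by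
  rw [Complex.inv_def, Complex.normSq_eq_norm_sq, norm_tPhase]
  simp

theorem tPhase_zpow_eight_mul (n : ℤ) : tPhase ^ (8 * n) = 1 := by
  have : tPhase ^ (8 : ℤ) = 1 := by
    have h : tPhase ^ 8 = (tPhase ^ 2) ^ 4 := by ring
    exact_mod_cast (h.trans (by rw [tPhase_sq, Complex.I_pow_four]))
  rw [zpow_mul, this, one_zpow]

theorem tPhase_zpow_four : tPhase ^ (4 : ℤ) = -1 := by
  have h : tPhase ^ 4 = (tPhase ^ 2) ^ 2 := by ring
  rw [tPhase_sq, Complex.I_sq] at h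
  exact (zpow_natCast tPhase 4).trans h

theorem prod_tPhase_zpow {α : Type*} (s : Finset α) (f : α → ℤ) :
    ∏ v ∈ s, tPhase ^ f v = tPhase ^ ∑ v ∈ s, f v := by
  classical
  induction s using Finset.induction_on with
  | empty => simp
  | insert v s hv ih =>
    rw [Finset.prod_insert hv, Finset.sum_insert hv, ih, zpow_add₀ tPhase_ne_zero]

theorem gateT_eq : gateT = Matrix.diagonal fun b => tPhase ^ (b.val : ℤ) := by
  rw [gateT]
  congr 1
  ext b
  rcases zmod_two_cases b with rfl | rfl <;> simp [tPhase, ZMod.val_one]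

theorem tildeOp_gateT_univ (m : ℕ) : tildeOp gateT (subcube (Finset.univ : Finset (Fin m)) 0) =
    Matrix.diagonal fun x => tPhase ^ tildeExponent x := by
  have hU : ∀ v : Cube m, (if subcube Finset.univ 0 v = 1 then
      (if Even (hammingNorm v) then gateT else gateTᴴ) else 1) =
      Matrix.diagonal fun b : ZMod 2 => tPhase ^ (paritySign v * (b.val : ℤ)) := by
    intro v
    rw [if_pos (by simp [subcube]), paritySign, gateT_eq]
    split_ifs
    · simp
    · rw [Matrix.diagonal_conjTranspose]
      congr 1
      ext b
      simp [star_tPhase, zpow_neg]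
  rw [tildeOp]
  simp only [hU, tensorOp_diagonal, prod_tPhase_zpow, tildeExponent]

theorem tState_apply (b : ZMod 2) : tState b = tPhase ^ (b.val : ℤ) / (Real.sqrt 2 : ℂ) := by
  rw [tState, gateT_eq, Matrix.mulVec_diagonal, plusState, mul_one_div]

/-- The Clifford correction of the teleported gate `T̃` at the vertex `v`, for the outcome `μ`. -/
noncomputable def correction {m : ℕ} (v : Cube m) (μ : ZMod 2) : Matrix (ZMod 2) (ZMod 2) ℂ :=
  if Even (hammingNorm v) then (if μ = 1 then gateS else 1) else (if μ = 0 then gateSᴴ else 1)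

theorem correction_eq_diagonal {m : ℕ} (v : Cube m) (μ : ZMod 2) :
    correction v μ = Matrix.diagonal fun x => correction v μ x x := by
  have h : ∀ d : ZMod 2 → ℂ, Matrix.diagonal d = Matrix.diagonal fun x => Matrix.diagonal d x x :=
    fun d => by simp
  rw [correction, gateS, ← Matrix.diagonal_one, Matrix.diagonal_conjTranspose]
  split_ifs <;> exact h _

/-- Teleportation at a single vertex. In all cases the correction turns the phase of the `T` state,
which depends on the outcome `μ`, into `T` (even weight) or `T†` (odd weight). -/
theorem correction_mul_tState {m : ℕ} (v : Cube m) (e x μ : ZMod 2) :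
    correction v μ x x * ((sign (e * (μ - x)) : ℤ) * tState (μ - x)) =
    ((sign (e * μ) : ℤ) * tPhase ^ (μ.val : ℤ) / (Real.sqrt 2 : ℂ)) *
      ((sign (e * x) : ℤ) * tPhase ^ (paritySign v * (x.val : ℤ))) := by
  have h0 := tPhase_ne_zero
  have h2 : (Real.sqrt 2 : ℂ) ≠ 0 := by simp
  have hI : Complex.I = tPhase ^ 2 := tPhase_sq.symm
  have hs : (starRingEnd ℂ) tPhase = tPhase⁻¹ := star_tPhase
  by_cases hv : Even (hammingNorm v) <;> rcases zmod_two_cases x with rfl | rfl <;>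
    rcases zmod_two_cases μ with rfl | rfl <;> rcases zmod_two_cases e with rfl | rfl <;>
    simp [correction, hv, tState_apply, paritySign, gateS, hI, hs, ZMod.val_one] <;> field_simp

theorem teleport_eq {m : ℕ} (ψ : (Cube m → ZMod 2) → ℂ) (e μ : Cube m → ZMod 2) :
    teleport ψ (opZ e *ᵥ productState fun _ => tState) μ =
      (∏ v, ((sign (e v * μ v) : ℤ) * tPhase ^ ((μ v).val : ℤ) / (Real.sqrt 2 : ℂ))) •
        (opZ e *ᵥ tildeOp gateT (subcube Finset.univ 0) *ᵥ ψ) := by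
  have hd : (fun v => correction v (μ v)) =
      fun v => Matrix.diagonal fun x => correction v (μ v) x x :=
    funext fun v => correction_eq_diagonal v (μ v)
  ext x
  change ((tensorOp fun v => correction v (μ v)) *ᵥ
    fun x => ψ x * (opZ e *ᵥ productState fun _ => tState) (μ - x)) x = _
  rw [hd]
  rw [tensorOp_diagonal, tildeOp_gateT_univ, opZ_eq, Matrix.mulVec_diagonal, Pi.smul_apply,
    Matrix.mulVec_diagonal, Matrix.mulVec_diagonal, Matrix.mulVec_diagonal]
  have key := Finset.prod_congr (rfl : (Finset.univ : Finset (Cube m)) = Finset.univ)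
    fun v _ => correction_mul_tState v (e v) (x v) (μ v)
  simp only [Finset.prod_mul_distrib] at key
  simp only [dotProduct, sign_sum, Int.cast_prod, productState, tildeExponent, smul_eq_mul,
    ← prod_tPhase_zpow, Pi.sub_apply]
  linear_combination ψ x * key

/-! ### Detection of faults -/

/-- A word of weight `1`, `2` or `3` is not orthogonal to `RM(1)`: the constant word detects odd
weights, and a coordinate on which they differ detects two vertices. -/
theorem exists_mem_RM_one_dotProduct_eq_one {m : ℕ} {e : Cube m → ZMod 2}
    (h1 : 1 ≤ hammingNorm e) (h3 : hammingNorm e ≤ 3) : ∃ s ∈ RM m 1, e ⬝ᵥ s = 1 := by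
  have hdot : ∀ s : Cube m → ZMod 2, e ⬝ᵥ s = ∑ v ∈ Finset.univ.filter (fun v => e v ≠ 0), s v := by
    intro s
    rw [Finset.sum_filter, dotProduct]
    refine Finset.sum_congr rfl fun v _ => ?_
    rcases zmod_two_cases (e v) with h | h <;> simp [h]
  rw [RM_eq_monomialSpan]
  have hmem : ∀ S : Finset (Fin m), S.card ≤ 1 →
      monomialWord S ∈ monomialSpan {S : Finset (Fin m) | S.card ≤ 1} :=
    fun S hS => monomialWord_mem_monomialSpan hS
  by_cases h2 : hammingNorm e = 2
  · obtain ⟨u, w, huw, hs⟩ := Finset.card_eq_two.1 h2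
    obtain ⟨j, hj⟩ := Function.ne_iff.1 huw
    refine ⟨_, hmem {j} (by simp), ?_⟩
    have key : ∀ a b : ZMod 2, a ≠ b → a + b = 1 := by decide
    rw [hdot, hs, Finset.sum_pair huw]
    simpa [monomialWord] using key _ _ hj
  · refine ⟨_, hmem ∅ (by simp), ?_⟩
    rw [hdot]
    simp only [monomialWord, Finset.prod_empty, Finset.sum_const, nsmul_eq_mul, mul_one]
    change ((hammingNorm e : ℕ) : ZMod 2) = 1
    obtain h | h : hammingNorm e = 1 ∨ hammingNorm e = 3 := by omega
    · rw [h]; rfl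
    · rw [h]; rfl

/-! ### The logical action on the big unfolded code -/

theorem diagonal_mul_eq_mul_diagonal {α β : Type*} [Fintype α] [Fintype β] [DecidableEq α]
    [DecidableEq β] {M : Matrix α β ℂ} {d : α → ℂ} {d' : β → ℂ}
    (h : ∀ x a, M x a ≠ 0 → d x = d' a) :
    Matrix.diagonal d * M = M * Matrix.diagonal d' := by
  ext x a
  rw [Matrix.diagonal_mul, Matrix.mul_diagonal, mul_comm]
  by_cases h0 : M x a = 0
  · rw [h0, zero_mul, zero_mul]
  · rw [h x a h0]

section BigUnfoldedEncoder

/-- The encoders of the big unfolded code for the standard subcubes. -/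
abbrev IsBigUnfoldedEncoder (E : Matrix (Cube 6 → ZMod 2) (Fin 3 → ZMod 2) ℂ) : Prop :=
  IsEncoder bigUnfolded (fun k => subcube (logicalType k)ᶜ 0) (fun k => subcube (logicalType k) 0) E

variable {E : Matrix (Cube 6 → ZMod 2) (Fin 3 → ZMod 2) ℂ}

theorem tPhase_zpow_tildeExponent (hE : IsBigUnfoldedEncoder E) {x : Cube 6 → ZMod 2} {a : Fin 3 → ZMod 2}
    (h0 : E x a ≠ 0) :
    tPhase ^ tildeExponent x = if ∀ k, a k = 1 then -1 else 1 := by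
  obtain ⟨n, hn⟩ := exists_tildeExponent_eq
    (hE.mem_of_apply_ne_zero isLogicalBasis_bigUnfolded h0)
  rw [hn, zpow_add₀ tPhase_ne_zero, tPhase_zpow_eight_mul, mul_one]
  split_ifs
  · exact tPhase_zpow_four
  · exact zpow_zero _

theorem tildeOp_mulVec_encoded (hE : IsBigUnfoldedEncoder E) (φ : (Fin 3 → ZMod 2) → ℂ) :
    tildeOp gateT (subcube Finset.univ 0) *ᵥ E *ᵥ φ = E *ᵥ CCZ *ᵥ φ := by
  rw [tildeOp_gateT_univ, CCZ, Matrix.mulVec_mulVec, Matrix.mulVec_mulVec,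
    diagonal_mul_eq_mul_diagonal fun x a => tPhase_zpow_tildeExponent hE (x := x) (a := a)]

theorem tildeOp_mul_encoder (hE : IsBigUnfoldedEncoder E) :
    tildeOp gateT (subcube Finset.univ 0) * E = E * CCZ := by
  ext x a
  have h := congrFun (tildeOp_mulVec_encoded hE (Pi.single a 1)) x
  rw [Matrix.mulVec_mulVec, Matrix.mulVec_mulVec, Matrix.mulVec_single_one,
    Matrix.mulVec_single_one] at h
  exact h

/-- Every outcome of the teleportation, with `Z` errors `e` on the states `|T⟩`, yields the encoded
`|CCZ⟩` with the same errors. -/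
theorem teleport_encoded_plus (hE : IsBigUnfoldedEncoder E) (e μ : Cube 6 → ZMod 2) :
    teleport (E *ᵥ productState fun _ => plusState) (opZ e *ᵥ productState fun _ => tState) μ =
      (∏ v, ((sign (e v * μ v) : ℤ) * tPhase ^ ((μ v).val : ℤ) / (Real.sqrt 2 : ℂ))) •
        (opZ e *ᵥ E *ᵥ cczState) := by
  rw [teleport_eq, tildeOp_mulVec_encoded hE, cczState]

end BigUnfoldedEncoder

theorem sqrt_two_pow_sixty_four : (Real.sqrt 2 : ℂ) ^ 64 = 2 ^ 32 := by
  rw [show 64 = 2 * 32 from rfl, pow_mul]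
  norm_cast
  rw [Real.sq_sqrt (by norm_num)]
  norm_num

end BigUnfolded

open BigUnfolded in
theorem mainTheorem1 :
    -- the code is `QRM_6(1, 2)` with twelve extra `Z` stabilizers, one square for each type other
    -- than `{1,2}`, `{3,4}`, `{5,6}`, and the choice of these squares is irrelevant
    (bigUnfolded.xStab = (QRM 6 1 2 (by norm_num)).xStab ∧
      (∀ c : Finset (Fin 6) → Cube 6,
        bigUnfolded.zStab = (QRM 6 1 2 (by norm_num)).zStab ⊔
          Submodule.span (ZMod 2) {w | ∃ J ∈ extraTypes, w = subcube J (c J)}) ∧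
      Module.finrank (ZMod 2) (QRM 6 1 2 (by norm_num)).zStab = 42 ∧
      extraTypes.ncard = 12 ∧
      Module.finrank (ZMod 2) bigUnfolded.zStab = 54) ∧
    -- it encodes three logical qubits, inside the code space of `QRM_6(1, 2)`
    (bigUnfolded.codeSpace ≤ (QRM 6 1 2 (by norm_num)).codeSpace ∧
      Module.finrank ℂ bigUnfolded.codeSpace = 2 ^ 3) ∧
    -- the standard subcubes define an encoder of the logical qubits `{1,2}`, `{3,4}`, `{5,6}`
    (∃ E : Matrix (Cube 6 → ZMod 2) (Fin 3 → ZMod 2) ℂ,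
      IsEncoder bigUnfolded (fun k => subcube (logicalType k)ᶜ 0)
        (fun k => subcube (logicalType k) 0) E) ∧
    ∀ E : Matrix (Cube 6 → ZMod 2) (Fin 3 → ZMod 2) ℂ,
      IsEncoder bigUnfolded (fun k => subcube (logicalType k)ᶜ 0)
        (fun k => subcube (logicalType k) 0) E →
      -- all other subcubes of these types represent the same logical operators
      (∀ (k : Fin 3) (v : Cube 6),
        opX (subcube (logicalType k)ᶜ v) * E = E * opX (Pi.single k 1) ∧
        opZ (subcube (logicalType k) v) * E = E * opZ (Pi.single k 1)) ∧
      -- the logical action of `T̃` on the whole cube is `CCZ`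
      tildeOp gateT (subcube Finset.univ 0) * E = E * CCZ ∧
      -- from 64 states `|T⟩` and the encoded `|+++⟩`, every outcome yields the encoded `|CCZ⟩`
      (∀ μ : Cube 6 → ZMod 2, ∃ z : ℂ, ‖z‖ = 1 ∧
        teleport (E *ᵥ productState fun _ => plusState) (productState fun _ => tState) μ =
          (z / 2 ^ 32) • (E *ᵥ cczState)) ∧
      -- `Z` errors on one, two or three of the states `|T⟩` are detected by an `X` stabilizer
      (∀ e : Cube 6 → ZMod 2, 1 ≤ hammingNorm e → hammingNorm e ≤ 3 →
        ∃ s ∈ bigUnfolded.xStab, ∀ μ : Cube 6 → ZMod 2,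
          opX s *ᵥ teleport (E *ᵥ productState fun _ => plusState)
              (opZ e *ᵥ productState fun _ => tState) μ =
            -teleport (E *ᵥ productState fun _ => plusState)
              (opZ e *ᵥ productState fun _ => tState) μ) := by
  refine ⟨⟨rfl, ?_, ?_, ncard_extraTypes, finrank_Subcubes_extraTypes⟩, ⟨?_, ?_⟩, ?_, ?_⟩
  · intro c
    rw [zStab_QRM_six]
    exact Subcubes_extraTypes_eq c
  · rw [zStab_QRM_six]
    exact finrank_RM_six_three
  · rintro ψ ⟨hX, hZ⟩
    refine ⟨hX, fun b hb => hZ b ?_⟩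
    rw [zStab_QRM_six] at hb
    exact RM_three_le_Subcubes hb
  · exact isLogicalBasis_bigUnfolded.isEncoder.finrank_codeSpace
  · exact ⟨_, isLogicalBasis_bigUnfolded.isEncoder⟩
  · intro E hE
    refine ⟨fun k v => ⟨?_, ?_⟩, tildeOp_mul_encoder hE, fun μ => ?_, fun e h1 h3 => ?_⟩
    · exact hE.opX_mul_of_sub_mem (subcube_compl_logicalType_sub_mem k v 0)
    · exact hE.opZ_mul_of_sub_mem (subcube_logicalType_sub_mem k v 0)
    · refine ⟨∏ v, tPhase ^ ((μ v).val : ℤ), ?_, ?_⟩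
      · simp [norm_tPhase]
      · -- the fault-free case is that of the empty error word
        have hZ : opZ (0 : Cube 6 → ZMod 2) = 1 := by simp [opZ_eq]
        have := teleport_encoded_plus hE 0 μ
        rw [hZ, Matrix.one_mulVec, Matrix.one_mulVec] at this
        rw [this, ← sqrt_two_pow_sixty_four]
        simp [Finset.prod_div_distrib, ZMod.card]
    · obtain ⟨s, hs, hes⟩ := exists_mem_RM_one_dotProduct_eq_one h1 h3
      refine ⟨s, hs, fun μ => ?_⟩
      rw [teleport_encoded_plus hE, Matrix.mulVec_smul, Matrix.mulVec_mulVec (M := opX s),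
        opX_mul_opZ_of_dotProduct_eq_one hes, Matrix.neg_mulVec, ← Matrix.mulVec_mulVec,
        Matrix.mulVec_mulVec (M := opX s), hE.opX_mul hs, smul_neg]
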